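/- Let $d$ be a positive integer and let $A(n)$, $n\in\mathbb{Z}$, be invertible real $d\times d$ matrices with $\sup_{n\in\mathbb{Z}}\|A(n)\|<\infty$ and $\sup_{n\in\mathbb{Z}}\|A(n)^{-1}\|<\infty$. Let $X(n)$ be the fundamental matrix of the system $x(n+1)=A(n)x(n)$, i.e. $X(0)=I$ and $X(n+1)=A(n)X(n)$ for all $n\in\mathbb{Z}$. The system is said to have an exponential dichotomy on $\mathbb{Z}$ if there are $K\ge 1$, $\rho\in(0,1)$ and a matrix $P=P^2$ with $\|X(n)PX(k)^{-1}\|\le K\rho^{\,n-k}$ for $n\ge k$ and $\|X(n)(I-P)X(k)^{-1}\|\le K\rho^{\,k-n}$ for $n\le k$. Let $\Sigma(A)$ be the set of all $\lambda>0$ such that the system $x(n+1)=\lambda^{-1}A(n)x(n)$ does not have an exponential dichotomy on $\mathbb{Z}$. Suppose that the system satisfies the full spectrum condition: $\Sigma(A)=[a_1,b_1]\cup\dots\cup[a_d,b_d]$ for some $0<a_1\le b_1<a_2\le b_2<\dots<a_d\le b_d$. Then the system is kinematically similar to a diagonal system: there are invertible real $d\times d$ matrices $F(n)$, $n\in\mathbb{Z}$,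 with $\sup_{n}\|F(n)\|<\infty$ and $\sup_{n}\|F(n)^{-1}\|<\infty$, and real diagonal matrices $D(n)$, such that $F(n+1)^{-1}A(n)F(n)=D(n)$ for all $n\in\mathbb{Z}$; that is, $y(n)=F(n)^{-1}x(n)$ transforms $x(n+1)=A(n)x(n)$ into $y(n+1)=D(n)y(n)$. -/

import Mathlib

namespace DiffSystem

noncomputable section

/- Matrices carry the norm induced by the sup norm of vectors, i.e. the maximal absolute row sum.
All matrix norms are equivalent, so the notions below do not depend on this choice. -/
attribute [local instance] Matrix.linftyOpNormedAddCommGroup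

/-- A matrix function on the integers is bounded in norm. -/
def IsBounded {d : ℕ} (F : ℤ → Matrix (Fin d) (Fin d) ℝ) : Prop :=
  ∃ M : ℝ, ∀ n : ℤ, ‖F n‖ ≤ M

/-- The product `A (n-1) * ⋯ * A 0`. -/
def forwardProd {d : ℕ} (A : ℤ → Matrix (Fin d) (Fin d) ℝ) : ℕ → Matrix (Fin d) (Fin d) ℝ
  | 0 => 1
  | n + 1 => A (n : ℤ) * forwardProd A n

/-- The product `(A (-m))⁻¹ * ⋯ * (A (-1))⁻¹`. -/
def backwardProd {d : ℕ} (A : ℤ → Matrix (Fin d) (Fin d) ℝ) : ℕ → Matrix (Fin d) (Fin d) ℝ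
  | 0 => 1
  | m + 1 => (A (-((m : ℤ) + 1)))⁻¹ * backwardProd A m

/-- The fundamental matrix `X` of `x (n+1) = A n * x n` with `X 0 = 1`. -/
def fundamentalMatrix {d : ℕ} (A : ℤ → Matrix (Fin d) (Fin d) ℝ) :
    ℤ → Matrix (Fin d) (Fin d) ℝ
  | Int.ofNat n => forwardProd A n
  | Int.negSucc m => backwardProd A (m + 1)

/-- Exponential dichotomy of `x (n+1) = A n * x n` on the integers. -/
def HasExpDichotomy {d : ℕ} (A : ℤ → Matrix (Fin d) (Fin d) ℝ) : Prop :=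
  ∃ (K ρ : ℝ) (P : Matrix (Fin d) (Fin d) ℝ), 1 ≤ K ∧ 0 < ρ ∧ ρ < 1 ∧ P * P = P ∧
    (∀ n k : ℤ, k ≤ n →
      ‖fundamentalMatrix A n * P * (fundamentalMatrix A k)⁻¹‖ ≤ K * ρ ^ (n - k)) ∧
    (∀ n k : ℤ, n ≤ k →
      ‖fundamentalMatrix A n * (1 - P) * (fundamentalMatrix A k)⁻¹‖ ≤ K * ρ ^ (k - n))

/-- The Sacker–Sell (exponential dichotomy) spectrum `Σ(A)`. -/
def sackerSellSpectrum {d : ℕ} (A : ℤ → Matrix (Fin d) (Fin d) ℝ) : Set ℝ :=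
  {μ : ℝ | 0 < μ ∧ ¬ HasExpDichotomy (fun n => μ⁻¹ • A n)}

/-- `Σ(A)` is the union of `d` spectral intervals
`0 < a₁ ≤ b₁ < a₂ ≤ b₂ < ⋯ < a_d ≤ b_d`, where `d` is the dimension of the system. -/
def FullSpectrum {d : ℕ} (A : ℤ → Matrix (Fin d) (Fin d) ℝ) : Prop :=
  ∃ a b : Fin d → ℝ, (∀ i, 0 < a i) ∧ (∀ i, a i ≤ b i) ∧ (∀ i j, i < j → b i < a j) ∧
    sackerSellSpectrum A = ⋃ i, Set.Icc (a i) (b i)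

/-- Kinematic similarity of `x (n+1) = A n * x n` and `y (n+1) = U n * y n`: there are invertible
`F n`, bounded together with their inverses, such that `y n = (F n)⁻¹ * x n` transforms the first
system into the second, that is, `U n = (F (n+1))⁻¹ * A n * F n`. -/
def KinematicallySimilar {d : ℕ} (A U : ℤ → Matrix (Fin d) (Fin d) ℝ) : Prop :=
  ∃ F : ℤ → Matrix (Fin d) (Fin d) ℝ,
    (∀ n, IsUnit (F n)) ∧ IsBounded F ∧ IsBounded (fun n => (F n)⁻¹) ∧
    ∀ n, U n = (F (n + 1))⁻¹ * A n * F n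

/-- The system `x (n+1) = A n * x n` is kinematically similar to a diagonal system. -/
def Diagonalizable {d : ℕ} (A : ℤ → Matrix (Fin d) (Fin d) ℝ) : Prop :=
  ∃ c : ℤ → Fin d → ℝ, KinematicallySimilar A (fun n => Matrix.diagonal (c n))

end

end DiffSystem

namespace DiffSystem

noncomputable section

attribute [local instance] Matrix.linftyOpNormedAddCommGroup Matrix.linftyOpNormedSpace

variable {d : ℕ} {A : ℤ → Matrix (Fin d) (Fin d) ℝ}

/-! Each spectral interval carries a line bundle invariant under the system, and these `d` bundles
stay uniformly apart. Pick rates just below `a i` and just above `b i`, outside the spectrum, with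
dichotomy projections `P i` and `R i`. On the whole of ℤ such projections are nested: the one at the
smaller rate is absorbed on both sides by the one at the larger (`SplitsAt.mul_eq`). So the `R i - P
i` are pairwise orthogonal idempotents. None vanishes, since a projection valid at both ends of an
interval would give a dichotomy inside it (`SplitsAt.between`).

Being `d` in number, they have rank one and are conjugated by one matrix `V` to the diagonal matrix
units. The columns of `Y n = X n * V` span the bundles. The dichotomy estimates at `n = k` bound the
evolved projections, and this is what bounds the inverse of `Y n` once its columns are normalized
(`exists_normalization`). -/

theorem fundamentalMatrix_zero (A : ℤ → Matrix (Fin d) (Fin d) ℝ) :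
    fundamentalMatrix A 0 = 1 := rfl

theorem fundamentalMatrix_succ (hA : ∀ n, IsUnit (A n)) (n : ℤ) :
    fundamentalMatrix A (n + 1) = A n * fundamentalMatrix A n := by
  have key (m : ℕ) : backwardProd A m
      = A (Int.negSucc m) * backwardProd A (m + 1) := by
    have h : -((m : ℤ) + 1) = Int.negSucc m := by omega
    rw [backwardProd, h, ← Matrix.mul_assoc,
      Matrix.mul_nonsing_inv _ ((Matrix.isUnit_iff_isUnit_det _).1 (hA _)), Matrix.one_mul]
  match n with
  | Int.ofNat n => rfl
  | Int.negSucc 0 => exact key 0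
  | Int.negSucc (m + 1) => exact key (m + 1)

theorem isUnit_fundamentalMatrix (hA : ∀ n, IsUnit (A n)) (n : ℤ) :
    IsUnit (fundamentalMatrix A n) := by
  induction n using Int.induction_on with
  | zero => exact isUnit_one
  | succ n ih => rw [fundamentalMatrix_succ hA]; exact (hA _).mul ih
  | pred n ih =>
    have h := fundamentalMatrix_succ hA (-(n : ℤ) - 1)
    rw [sub_add_cancel] at h
    rw [h] at ih
    rw [Matrix.isUnit_iff_isUnit_det, Matrix.det_mul] at ih
    exact (Matrix.isUnit_iff_isUnit_det _).2 (isUnit_of_mul_isUnit_right ih)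

theorem fundamentalMatrix_smul (hA : ∀ n, IsUnit (A n)) {c : ℝ} (hc : c ≠ 0) (n : ℤ) :
    fundamentalMatrix (fun n => c • A n) n = c ^ n • fundamentalMatrix A n := by
  have hcA : ∀ n, IsUnit (c • A n) := fun n => (hA n).smul (Units.mk0 c hc)
  induction n using Int.induction_on with
  | zero => simp [fundamentalMatrix_zero]
  | succ n ih =>
    rw [fundamentalMatrix_succ hcA, fundamentalMatrix_succ hA, ih, zpow_add_one₀ hc,
      Matrix.smul_mul, Matrix.mul_smul, smul_smul, mul_comm]
  | pred n ih =>
    have h := fundamentalMatrix_succ hcA (-(n : ℤ) - 1)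
    have h' := fundamentalMatrix_succ hA (-(n : ℤ) - 1)
    rw [sub_add_cancel] at h h'
    apply (hcA (-(n : ℤ) - 1)).mul_left_cancel
    rw [← h, ih, h', Matrix.smul_mul, Matrix.mul_smul, smul_smul, ← zpow_one_add₀ hc]
    congr 2
    ring

/-! ### Dichotomies at different rates, read on the unscaled system. -/

/-- The projection `P` splits the system exponentially at growth rate `μ`. -/
structure SplitsAt (A : ℤ → Matrix (Fin d) (Fin d) ℝ) (μ : ℝ)
    (P : Matrix (Fin d) (Fin d) ℝ) (K ρ : ℝ) : Prop where
  one_le : 1 ≤ K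
  pos : 0 < ρ
  lt_one : ρ < 1
  idem : P * P = P
  stable : ∀ n k : ℤ, k ≤ n →
    ‖fundamentalMatrix A n * P * (fundamentalMatrix A k)⁻¹‖ ≤ K * (ρ * μ) ^ (n - k)
  unstable : ∀ n k : ℤ, n ≤ k →
    ‖fundamentalMatrix A n * (1 - P) * (fundamentalMatrix A k)⁻¹‖ ≤ K * (ρ / μ) ^ (k - n)

theorem norm_scaled (hA : ∀ n, IsUnit (A n)) {μ : ℝ} (hμ : 0 < μ)
    (P : Matrix (Fin d) (Fin d) ℝ) (n k : ℤ) :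
    ‖fundamentalMatrix (fun n => μ⁻¹ • A n) n * P *
      (fundamentalMatrix (fun n => μ⁻¹ • A n) k)⁻¹‖ =
    μ ^ (k - n) * ‖fundamentalMatrix A n * P * (fundamentalMatrix A k)⁻¹‖ := by
  have hμ' : μ⁻¹ ≠ 0 := (inv_pos.2 hμ).ne'
  have hinv : (μ⁻¹ ^ k • fundamentalMatrix A k)⁻¹ = μ ^ k • (fundamentalMatrix A k)⁻¹ := by
    apply Matrix.inv_eq_left_inv
    rw [Matrix.smul_mul, Matrix.mul_smul, smul_smul, Matrix.nonsing_inv_mul _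
      ((Matrix.isUnit_iff_isUnit_det _).1 (isUnit_fundamentalMatrix hA k)), ← mul_zpow,
      mul_inv_cancel₀ hμ.ne', one_zpow, one_smul]
  rw [fundamentalMatrix_smul hA hμ', fundamentalMatrix_smul hA hμ', hinv, Matrix.smul_mul,
    Matrix.smul_mul, Matrix.mul_smul, smul_smul, norm_smul, Real.norm_of_nonneg (by positivity),
    zpow_sub₀ hμ.ne', inv_zpow, div_eq_inv_mul]

theorem hasExpDichotomy_iff (hA : ∀ n, IsUnit (A n)) {μ : ℝ} (hμ : 0 < μ) :
    HasExpDichotomy (fun n => μ⁻¹ • A n) ↔ ∃ P K ρ, SplitsAt A μ P K ρ := by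
  have e1 (K ρ x : ℝ) (n k : ℤ) :
      μ ^ (k - n) * x ≤ K * ρ ^ (n - k) ↔ x ≤ K * (ρ * μ) ^ (n - k) := by
    have h : K * (ρ * μ) ^ (n - k) = K * ρ ^ (n - k) / μ ^ (k - n) := by
      rw [mul_zpow, ← neg_sub k n, zpow_neg μ, div_eq_mul_inv, mul_assoc]
    rw [h, le_div_iff₀ (zpow_pos hμ _), mul_comm]
  have e2 (K ρ x : ℝ) (n k : ℤ) :
      μ ^ (k - n) * x ≤ K * ρ ^ (k - n) ↔ x ≤ K * (ρ / μ) ^ (k - n) := by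
    rw [div_zpow, mul_div_assoc', le_div_iff₀ (zpow_pos hμ _), mul_comm]
  constructor
  · rintro ⟨K, ρ, P, h1, h2, h3, h4, h5, h6⟩
    refine ⟨P, K, ρ, h1, h2, h3, h4, fun n k h => ?_, fun n k h => ?_⟩
    · have := h5 n k h
      rwa [norm_scaled hA hμ, e1] at this
    · have := h6 n k h
      rwa [norm_scaled hA hμ, e2] at this
  · rintro ⟨P, K, ρ, h1, h2, h3, h4, h5, h6⟩
    refine ⟨K, ρ, P, h1, h2, h3, h4, fun n k h => ?_, fun n k h => ?_⟩
    · rw [norm_scaled hA hμ, e1]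
      exact h5 n k h
    · rw [norm_scaled hA hμ, e2]
      exact h6 n k h

theorem eq_zero_of_norm_le_geometric {M : Matrix (Fin d) (Fin d) ℝ} {C r : ℝ}
    (hr : 0 ≤ r) (hr1 : r < 1) (h : ∀ n : ℕ, ‖M‖ ≤ C * r ^ n) : M = 0 := by
  have ht : Filter.Tendsto (fun n : ℕ => C * r ^ n) Filter.atTop (nhds 0) := by
    simpa using (tendsto_pow_atTop_nhds_zero_of_lt_one hr hr1).const_mul C
  exact norm_le_zero_iff.1 (ge_of_tendsto' ht h)

theorem norm_transition_mul_le (hA : ∀ n, IsUnit (A n)) (P Q : Matrix (Fin d) (Fin d) ℝ)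
    (n : ℤ) :
    ‖P * Q‖ ≤ ‖fundamentalMatrix A 0 * P * (fundamentalMatrix A n)⁻¹‖ *
      ‖fundamentalMatrix A n * Q * (fundamentalMatrix A 0)⁻¹‖ := by
  refine le_of_eq_of_le ?_ (Matrix.linfty_opNorm_mul _ _)
  rw [fundamentalMatrix_zero, inv_one, Matrix.one_mul, Matrix.mul_one, Matrix.mul_assoc P,
    ← Matrix.mul_assoc _ _ Q, Matrix.nonsing_inv_mul _
      ((Matrix.isUnit_iff_isUnit_det _).1 (isUnit_fundamentalMatrix hA n)), Matrix.one_mul]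

theorem rate_bound {l m ρ σ : ℝ} (hl : 0 < l) (hlm : l ≤ m) (hρ : 0 < ρ) (hρ1 : ρ < 1)
    (hσ : 0 < σ) (hσ1 : σ < 1) : 0 ≤ σ / m * (ρ * l) ∧ σ / m * (ρ * l) < 1 := by
  have hm : 0 < m := hl.trans_le hlm
  refine ⟨by positivity, ?_⟩
  rw [div_mul_eq_mul_div, div_lt_one hm]
  calc σ * (ρ * l) ≤ 1 * (ρ * l) := by gcongr
    _ = ρ * l := one_mul _
    _ < 1 * l := by gcongr
    _ ≤ m := by rwa [one_mul]

/-- Both `(1 - Q) * P` and `P * (1 - Q)` factor through time `n`; decay at the lower rate against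
growth at the higher one leaves a geometric factor of ratio below one, so both vanish. -/
theorem SplitsAt.mul_eq {l m : ℝ} {P Q : Matrix (Fin d) (Fin d) ℝ} {K L ρ σ : ℝ}
    (hA : ∀ n, IsUnit (A n)) (hl : 0 < l) (hlm : l ≤ m)
    (hP : SplitsAt A l P K ρ) (hQ : SplitsAt A m Q L σ) : Q * P = P ∧ P * Q = P := by
  have hK : 0 ≤ K := zero_le_one.trans hP.one_le
  have hL : 0 ≤ L := zero_le_one.trans hQ.one_le
  have hρ := hP.pos
  have hσ := hQ.pos
  have hm : 0 < m := hl.trans_le hlm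
  obtain ⟨r0, r1⟩ := rate_bound hl hlm hP.pos hP.lt_one hQ.pos hQ.lt_one
  have h1 : (1 - Q) * P = 0 := by
    refine eq_zero_of_norm_le_geometric (C := L * K) r0 r1 fun n => ?_
    refine (norm_transition_mul_le hA _ _ (n : ℤ)).trans ?_
    have a := hQ.unstable 0 n (by positivity)
    have b := hP.stable n 0 (by positivity)
    rw [sub_zero, zpow_natCast] at a b
    refine (mul_le_mul a b (norm_nonneg _) (by positivity)).trans_eq ?_
    rw [mul_pow (σ / m)]
    ring
  -- With the factors in this order the estimates decay only through negative times.
  have h2 : P * (1 - Q) = 0 := by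
    refine eq_zero_of_norm_le_geometric (C := K * L) r0 r1 fun n => ?_
    refine (norm_transition_mul_le hA _ _ (-n : ℤ)).trans ?_
    have a := hP.stable 0 (-n) (by omega)
    have b := hQ.unstable (-n) 0 (by omega)
    rw [zero_sub, neg_neg, zpow_natCast] at a b
    refine (mul_le_mul a b (norm_nonneg _) (by positivity)).trans_eq ?_
    rw [mul_pow (σ / m)]
    ring
  rw [Matrix.sub_mul, Matrix.one_mul, sub_eq_zero] at h1
  rw [Matrix.mul_sub, Matrix.mul_one, sub_eq_zero] at h2
  exact ⟨h1.symm, h2.symm⟩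

/-- The stable estimate survives raising the rate and the unstable one survives lowering it, so each
end supplies one half. -/
theorem SplitsAt.between {l m ν : ℝ} {P : Matrix (Fin d) (Fin d) ℝ} {K L ρ σ : ℝ}
    (hl : 0 < l) (hlν : l ≤ ν) (hνm : ν ≤ m)
    (hP : SplitsAt A l P K ρ) (hQ : SplitsAt A m P L σ) :
    SplitsAt A ν P (max K L) (max ρ σ) := by
  have hν : 0 < ν := hl.trans_le hlν
  have hm : 0 < m := hν.trans_le hνm
  have hρ := hP.pos
  have hσ := hQ.pos
  have hK : 0 < K := zero_lt_one.trans_le hP.one_le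
  have hmax : 0 < max ρ σ := lt_max_of_lt_left hP.pos
  have hmaxK : 0 < max K L := lt_max_of_lt_left hK
  refine ⟨le_max_of_le_left hP.one_le, hmax, max_lt hP.lt_one hQ.lt_one, hP.idem,
    fun n k h => (hP.stable n k h).trans ?_, fun n k h => (hQ.unstable n k h).trans ?_⟩
  · obtain ⟨j, hj⟩ := Int.eq_ofNat_of_zero_le (sub_nonneg.2 h)
    rw [hj, zpow_natCast, zpow_natCast]
    gcongr
    · exact le_max_left _ _
    · exact le_max_left _ _
  · obtain ⟨j, hj⟩ := Int.eq_ofNat_of_zero_le (sub_nonneg.2 h)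
    rw [hj, zpow_natCast, zpow_natCast]
    gcongr
    · exact le_max_right _ _
    · exact le_max_right _ _

theorem SplitsAt.norm_conj_le {l : ℝ} {P : Matrix (Fin d) (Fin d) ℝ} {K ρ : ℝ}
    (hP : SplitsAt A l P K ρ) (n : ℤ) :
    ‖fundamentalMatrix A n * P * (fundamentalMatrix A n)⁻¹‖ ≤ K := by
  simpa using hP.stable n n le_rfl

theorem exists_gap {a b : Fin d → ℝ} (ha : ∀ i, 0 < a i) (hab : ∀ i j, i < j → b i < a j) :
    ∃ ε > 0, (∀ i, ε < a i) ∧ ∀ i j, i < j → b i + ε < a j - ε := by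
  have h0 : Filter.Tendsto (fun ε : ℝ => ε) (nhdsWithin 0 (Set.Ioi 0)) (nhds 0) :=
    tendsto_nhdsWithin_of_tendsto_nhds Filter.tendsto_id
  have h1 : ∀ᶠ ε in nhdsWithin (0 : ℝ) (Set.Ioi 0), ∀ i, ε < a i :=
    Filter.eventually_all.2 fun i => h0.eventually_lt_const (ha i)
  have h2 : ∀ᶠ ε in nhdsWithin (0 : ℝ) (Set.Ioi 0), ∀ i j, i < j → b i + ε < a j - ε := by
    refine Filter.eventually_all.2 fun i => Filter.eventually_all.2 fun j => ?_
    by_cases hij : i < j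
    · have : 0 < (a j - b i) / 2 := by linarith [hab i j hij]
      filter_upwards [h0.eventually_lt_const this] with ε hε _
      linarith
    · exact Filter.Eventually.of_forall fun ε h => absurd h hij
  obtain ⟨ε, ⟨h, h'⟩, hε⟩ := ((h1.and h2).and self_mem_nhdsWithin).exists
  exact ⟨ε, hε, h, h'⟩

/-! ### Linear algebra: simultaneous diagonalization and column scaling. -/

theorem abs_entry_le_norm (M : Matrix (Fin d) (Fin d) ℝ) (i j : Fin d) : |M i j| ≤ ‖M‖ := by
  have h1 : ‖M i j‖ ≤ ∑ j, ‖M i j‖ :=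
    Finset.single_le_sum (f := fun j => ‖M i j‖) (fun _ _ => norm_nonneg _) (Finset.mem_univ j)
  have h2 : (∑ j, ‖M i j‖₊) ≤ Finset.univ.sup fun i => ∑ j, ‖M i j‖₊ :=
    Finset.le_sup (f := fun i => ∑ j, ‖M i j‖₊) (Finset.mem_univ i)
  rw [Matrix.linfty_opNorm_def, ← Real.norm_eq_abs]
  refine h1.trans ?_
  simpa only [NNReal.coe_sum, coe_nnnorm] using NNReal.coe_le_coe.2 h2

theorem norm_le_of_abs_entry_le {M : Matrix (Fin d) (Fin d) ℝ} {C : ℝ} (hC : 0 ≤ C)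
    (h : ∀ i j, |M i j| ≤ C) : ‖M‖ ≤ d * C := by
  lift C to NNReal using hC
  rw [Matrix.linfty_opNorm_def]
  have : (Finset.univ.sup fun i => ∑ j, ‖M i j‖₊) ≤ d * C := by
    refine Finset.sup_le fun i _ => ?_
    refine (Finset.sum_le_card_nsmul _ _ C fun j _ => ?_).trans_eq (by simp)
    exact_mod_cast h i j
  exact_mod_cast this

/-- Nonzero pairwise orthogonal idempotents, as many as the dimension, are simultaneously
conjugate to the diagonal matrix units. -/
theorem exists_conj_single (Q : Fin d → Matrix (Fin d) (Fin d) ℝ) (hne : ∀ i, Q i ≠ 0)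
    (hidem : ∀ i, Q i * Q i = Q i) (horth : ∀ i j, i ≠ j → Q i * Q j = 0) :
    ∃ V : Matrix (Fin d) (Fin d) ℝ, IsUnit V ∧ ∀ i, Q i * V = V * Matrix.single i i 1 := by
  have hv : ∀ i, ∃ v, Matrix.mulVec (Q i) v ≠ 0 := by
    intro i
    by_contra! h
    exact hne i (Matrix.ext_of_mulVec_single fun j => by rw [h, Matrix.zero_mulVec])
  choose w hw using hv
  set v : Fin d → Fin d → ℝ := fun i => Matrix.mulVec (Q i) (w i) with hvdef
  have hself : ∀ i, Matrix.mulVec (Q i) (v i) = v i := fun i => by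
    simp only [hvdef, Matrix.mulVec_mulVec, hidem]
  have hoff : ∀ i j, i ≠ j → Matrix.mulVec (Q i) (v j) = 0 := fun i j h => by
    simp only [hvdef, Matrix.mulVec_mulVec, horth i j h, Matrix.zero_mulVec]
  -- Applying `Q i` to a linear relation isolates its `i`-th coefficient.
  have hlin : LinearIndependent ℝ v := by
    rw [Fintype.linearIndependent_iff]
    intro g hg i
    have h := congrArg (Matrix.mulVec (Q i)) hg
    rw [Matrix.mulVec_sum, Matrix.mulVec_zero,
      Finset.sum_eq_single i (fun j _ hj => by rw [Matrix.mulVec_smul, hoff i j hj.symm, smul_zero])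
        (by simp), Matrix.mulVec_smul, hself] at h
    exact (smul_eq_zero.1 h).resolve_right (hw i)
  refine ⟨(Matrix.of v).transpose, ?_, fun i => ?_⟩
  · rw [← Matrix.linearIndependent_cols_iff_isUnit]
    exact hlin
  · ext k j
    have hl : (Q i * (Matrix.of v).transpose) k j = Matrix.mulVec (Q i) (v j) k := rfl
    rw [hl]
    rcases eq_or_ne i j with rfl | h
    · simp [hself]
    · simp [hoff i j h, Matrix.mul_apply, h]

/-- An invertible matrix becomes, after normalizing its columns, bounded with bounded inverse if
the conjugates of the diagonal matrix units by it are bounded. -/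
theorem exists_normalization {Y : Matrix (Fin d) (Fin d) ℝ} (hY : IsUnit Y) {C : ℝ} (hC : 0 ≤ C)
    (h : ∀ i, ‖Y * Matrix.single i i 1 * Y⁻¹‖ ≤ C) :
    ∃ c : Fin d → ℝ, (∀ i, c i ≠ 0) ∧ ‖Y * Matrix.diagonal c‖ ≤ d ∧
      ‖(Matrix.diagonal c)⁻¹ * Y⁻¹‖ ≤ d * C := by
  have hdet := (Matrix.isUnit_iff_isUnit_det _).1 hY
  -- Each column is divided by its entry of largest modulus.
  have hmax : ∀ i, ∃ k, ∀ l, |Y l i| ≤ |Y k i| := fun i =>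
    haveI : Nonempty (Fin d) := ⟨i⟩
    Finite.exists_max fun l => |Y l i|
  choose k hk using hmax
  have hne : ∀ i, Y (k i) i ≠ 0 := by
    intro i h0
    refine hdet.ne_zero (Matrix.det_eq_zero_of_column_eq_zero i fun l => ?_)
    have := hk i l
    rw [h0, abs_zero] at this
    exact abs_nonpos_iff.1 this
  have hinv : (Matrix.diagonal fun i => (Y (k i) i)⁻¹)⁻¹ = Matrix.diagonal fun i => Y (k i) i := by
    apply Matrix.inv_eq_left_inv
    rw [Matrix.diagonal_mul_diagonal, ← Matrix.diagonal_one]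
    congr 1
    funext i
    exact mul_inv_cancel₀ (hne i)
  refine ⟨fun i => (Y (k i) i)⁻¹, fun i => inv_ne_zero (hne i), ?_, ?_⟩
  · rw [← mul_one (d : ℝ)]
    refine norm_le_of_abs_entry_le zero_le_one fun l i => ?_
    rw [Matrix.mul_diagonal, abs_mul, abs_inv, ← div_eq_mul_inv]
    exact div_le_one_of_le₀ (hk i l) (abs_nonneg _)
  · refine norm_le_of_abs_entry_le hC fun i j => ?_
    -- Row `i` of the rescaled inverse is row `k i` of the `i`-th projection.
    have he : (Y * Matrix.single i i (1 : ℝ) * Y⁻¹ : Matrix (Fin d) (Fin d) ℝ) (k i) j = Y (k i) i * Y⁻¹ i j := by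
      rw [Matrix.mul_assoc, Matrix.mul_apply, Finset.sum_eq_single i]
      · simp
      · intro l _ hl
        rw [Matrix.single_mul_apply_of_ne _ _ _ _ _ hl, mul_zero]
      · simp
    rw [hinv, Matrix.diagonal_mul, ← he]
    exact (abs_entry_le_norm _ _ _).trans (h i)

/-- A system with as many nonzero pairwise orthogonal idempotents as its dimension, whose
evolutions along the system stay bounded, is kinematically similar to a diagonal system. -/
theorem diagonalizable_of_idempotents (hA : ∀ n, IsUnit (A n))
    (Q : Fin d → Matrix (Fin d) (Fin d) ℝ) (hne : ∀ i, Q i ≠ 0)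
    (hidem : ∀ i, Q i * Q i = Q i) (horth : ∀ i j, i ≠ j → Q i * Q j = 0)
    (hbdd : ∀ i, ∃ C, ∀ n, ‖fundamentalMatrix A n * Q i * (fundamentalMatrix A n)⁻¹‖ ≤ C) :
    Diagonalizable A := by
  obtain ⟨V, hV, hQV⟩ := exists_conj_single Q hne hidem horth
  have hVdet := (Matrix.isUnit_iff_isUnit_det _).1 hV
  choose C hC using hbdd
  set B : ℝ := ∑ i, |C i| with hB
  have hB0 : 0 ≤ B := Finset.sum_nonneg fun _ _ => abs_nonneg _
  have hCB : ∀ i, C i ≤ B := fun i => (le_abs_self _).trans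
    (Finset.single_le_sum (f := fun i => |C i|) (fun _ _ => abs_nonneg _) (Finset.mem_univ i))
  set Y : ℤ → Matrix (Fin d) (Fin d) ℝ := fun n => fundamentalMatrix A n * V with hYdef
  have hY : ∀ n, IsUnit (Y n) := fun n => (isUnit_fundamentalMatrix hA n).mul hV
  have hYdet := fun n => (Matrix.isUnit_iff_isUnit_det _).1 (hY n)
  have hsingle : ∀ n i, ‖Y n * Matrix.single i i 1 * (Y n)⁻¹‖ ≤ B := by
    intro n i
    have : Y n * Matrix.single i i 1 * (Y n)⁻¹ =
        fundamentalMatrix A n * Q i * (fundamentalMatrix A n)⁻¹ := by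
      simp only [hYdef]
      rw [Matrix.mul_assoc _ V, ← hQV, Matrix.mul_inv_rev, ← Matrix.mul_assoc, ← Matrix.mul_assoc,
        Matrix.mul_assoc _ V, Matrix.mul_nonsing_inv _ hVdet, Matrix.mul_one]
    rw [this]
    exact (hC i n).trans (hCB i)
  choose c hc0 hc1 hc2 using fun n => exists_normalization (hY n) hB0 (hsingle n)
  have hdiag : ∀ n, IsUnit (Matrix.diagonal (c n)) := fun n => by
    rw [Matrix.isUnit_diagonal, Pi.isUnit_iff]
    exact fun i => (hc0 n i).isUnit
  -- Since `A n * Y n = Y (n + 1)`, only the change of column scaling remains.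
  refine ⟨fun n => (c (n + 1))⁻¹ * c n, fun n => Y n * Matrix.diagonal (c n),
    fun n => (hY n).mul (hdiag n), ⟨d, hc1⟩, ⟨d * B, fun n => ?_⟩, fun n => ?_⟩
  · beta_reduce
    rw [Matrix.mul_inv_rev]
    exact hc2 n
  · have hstep : A n * Y n = Y (n + 1) := by
      simp only [hYdef]
      rw [fundamentalMatrix_succ hA, Matrix.mul_assoc]
    have hinv : (Matrix.diagonal (c (n + 1)))⁻¹ = Matrix.diagonal (c (n + 1))⁻¹ := by
      apply Matrix.inv_eq_left_inv
      rw [Matrix.diagonal_mul_diagonal, ← Matrix.diagonal_one]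
      congr 1
      funext i
      exact inv_mul_cancel₀ (hc0 (n + 1) i)
    rw [Matrix.mul_assoc, ← Matrix.mul_assoc (A n), hstep, Matrix.mul_inv_rev, Matrix.mul_assoc,
      ← Matrix.mul_assoc (Y (n + 1))⁻¹, Matrix.nonsing_inv_mul _ (hYdet _), Matrix.one_mul, hinv,
      Matrix.diagonal_mul_diagonal]
    rfl

/-! ### Spectral projections of the intervals. -/

theorem FullSpectrum.diagonalizable (hA : ∀ n, IsUnit (A n)) (h : FullSpectrum A) :
    Diagonalizable A := by
  obtain ⟨a, b, ha, hab, hlt, hspec⟩ := h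
  obtain ⟨ε, hε, hεa, hgap⟩ := exists_gap ha hlt
  have hmono : ∀ i j, i ≤ j → b i ≤ b j ∧ a i ≤ a j := by
    intro i j hij
    rcases hij.eq_or_lt with rfl | hij
    · exact ⟨le_rfl, le_rfl⟩
    · exact ⟨(hlt i j hij).le.trans (hab j), (hab i).trans (hlt i j hij).le⟩
  have hres : ∀ μ, 0 < μ → (∀ i, μ < a i ∨ b i < μ) → ∃ P K ρ, SplitsAt A μ P K ρ := by
    intro μ hμ hout
    rw [← hasExpDichotomy_iff hA hμ]
    by_contra hno
    have hmem : μ ∈ sackerSellSpectrum A := ⟨hμ, hno⟩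
    rw [hspec, Set.mem_iUnion] at hmem
    obtain ⟨i, hi1, hi2⟩ := hmem
    rcases hout i with h | h <;> linarith
  have hlo0 : ∀ i, 0 < a i - ε := fun i => sub_pos.2 (hεa i)
  have hhi0 : ∀ i, 0 < b i + ε := fun i => by linarith [ha i, hab i]
  have hlo : ∀ i, ∃ P K ρ, SplitsAt A (a i - ε) P K ρ := by
    refine fun i => hres _ (hlo0 i) fun j => ?_
    rcases lt_or_ge j i with hj | hj
    · right; linarith [hgap j i hj]
    · left; linarith [(hmono i j hj).2]
  have hhi : ∀ i, ∃ P K ρ, SplitsAt A (b i + ε) P K ρ := by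
    refine fun i => hres _ (hhi0 i) fun j => ?_
    rcases le_or_gt j i with hj | hj
    · right; linarith [(hmono j i hj).1]
    · left; linarith [hgap i j hj]
  choose P K ρ hP using hlo
  choose R L σ hR using hhi
  have hPR : ∀ i, R i * P i = P i ∧ P i * R i = P i := fun i =>
    (hP i).mul_eq hA (hlo0 i) (by linarith [hab i]) (hR i)
  have hne : ∀ i, R i - P i ≠ 0 := by
    intro i h0
    have hi := hP i
    rw [← sub_eq_zero.1 h0] at hi
    have hs : a i ∈ sackerSellSpectrum A := by
      rw [hspec]
      exact Set.mem_iUnion.2 ⟨i, le_rfl, hab i⟩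
    exact hs.2 ((hasExpDichotomy_iff hA (ha i)).2
      ⟨_, _, _, hi.between (hlo0 i) (by linarith) (by linarith [hab i]) (hR i)⟩)
  refine diagonalizable_of_idempotents hA (fun i => R i - P i) hne (fun i => ?_)
    (fun i j hij => ?_) fun i => ⟨L i + K i, fun n => ?_⟩
  · simp only [Matrix.sub_mul, Matrix.mul_sub, (hP i).idem, (hR i).idem, (hPR i).1, (hPR i).2]
    abel
  · have key : ∀ i j, i < j → (R i - P i) * (R j - P j) = 0 ∧ (R j - P j) * (R i - P i) = 0 := by
      intro i j hij
      have hg := hgap i j hij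
      have e1 := (hR i).mul_eq hA (hhi0 i) (by linarith [hab j]) (hR j)
      have e2 := (hR i).mul_eq hA (hhi0 i) hg.le (hP j)
      have e3 := (hP i).mul_eq hA (hlo0 i) (by linarith [hab i, hab j]) (hR j)
      have e4 := (hP i).mul_eq hA (hlo0 i) (by linarith [hab i]) (hP j)
      constructor <;>
        simp only [Matrix.sub_mul, Matrix.mul_sub, e1.1, e1.2, e2.1, e2.2, e3.1, e3.2, e4.1, e4.2,
          sub_self]
    rcases lt_or_gt_of_ne hij with h | h
    · exact (key i j h).1
    · exact (key j i h).2
  · rw [Matrix.mul_sub, Matrix.sub_mul]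
    exact (norm_sub_le _ _).trans (add_le_add ((hR i).norm_conj_le n) ((hP i).norm_conj_le n))

end

end DiffSystem

theorem theorem2 {d : ℕ} (A : ℤ → Matrix (Fin d) (Fin d) ℝ)
    (hinv : ∀ n : ℤ, IsUnit (A n))
    (hbdd : DiffSystem.IsBounded A)
    (hbdd_inv : DiffSystem.IsBounded (fun n => (A n)⁻¹))
    (hfull : DiffSystem.FullSpectrum A) :
    DiffSystem.Diagonalizable A :=
  hfull.diagonalizable hinv
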